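/- Let $\mathbb H$ be the real quaternions with units $i,j,k$, conjugation $q\mapsto\overline q$ and modulus $|q|$. Put $d\mu_2(x)=\frac{dx}{2\pi}$ on $\mathbb R^2$ and $d\mu_4(\xi,b)=\frac{d\xi\,db}{(2\pi)^2}$ on $\mathbb R^2\times\mathbb R^2$. The spaces $L^p(\mathbb R^2,\mathbb H)$, $L^p(\mathbb R^4,\mathbb H)$ and the norms $\|\cdot\|_p$ are taken with respect to $\mu_2$ and $\mu_4$. For $g\in L^1(\mathbb R^2,\mathbb H)$ let $$\mathcal F_Q(g)(u,v)=\int_{\mathbb R^2}e^{-ix_1u}\,g(x)\,e^{-jx_2v}\,d\mu_2(x)$$ be the two-sided quaternion Fourier transform. For $\xi=(\xi_1,\xi_2)\in\mathbb R^2$ let $A_\xi=\operatorname{diag}(\xi_1,\xi_2)$. A window $\varphi\in L^1(\mathbb R^2,\mathbb H)\cap L^2(\mathbb R^2,\mathbb H)$, $\varphi\neq0$, is admissible if $$C_\varphi=\int_{\mathbb R^2}\bigl|\mathcal F_Q(\overline\varphi)(1-\xi_1,1-\xi_2)\bigr|^2\,\frac{d\mu_2(\xi)}{|\det A_\xi|}$$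 satisfies $0<C_\varphi<\infty$. The quaternion Stockwell transform of $f\in L^2(\mathbb R^2,\mathbb H)$ with window $\varphi$ is $$(S_\varphi^Qf)(\xi,b)=|\det A_\xi|^{1/2}\int_{\mathbb R^2}e^{-ix_1\xi_1}f(x)\,e^{-jx_2\xi_2}\,\overline{\varphi(A_\xi(x-b))}\,d\mu_2(x),\qquad \xi,b\in\mathbb R^2$$ (for $\det A_\xi=0$ it is understood to be $0$). **Lemma.** Let $\varphi$ be an admissible window such that for all $u,v,y\in\mathbb R$ $$\mathcal F_Q(\varphi)(u,v)\,e^{-jvy}=e^{-jvy}\,\mathcal F_Q(\varphi)(u,v)\quad\text{and}\quad \mathcal F_Q(j\varphi)(u,v)\,e^{-jvy}=j\,e^{-jvy}\,\mathcal F_Q(\varphi)(u,v).$$ Then for every $f\in L^2(\mathbb R^2,\mathbb H)$ and every real $p\in[2,\infty)$ the function $S_\varphi^Qf$ belongs to $L^p(\mathbb R^4,\mathbb H)$, and $$\|S_\varphi^Qf\|_p\le C_\varphi^{1/p}\,\|\varphi\|_2^{\,1-2/p}\,\|f\|_2 .$$ -/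

import Mathlib

open MeasureTheory
open scoped Quaternion ENNReal

namespace QStockwell

noncomputable section

/-- The plane `ℝ²`, with points written as `(x₁, x₂)`. Only its Lebesgue measure is used. -/
abbrev Plane : Type := ℝ × ℝ

/-- The normalized Lebesgue measure `dμ₂(x) = dx / (2π)` on `ℝ²`. -/
def mu2 : Measure Plane := ENNReal.ofReal (1 / (2 * Real.pi)) • volume

/-- The normalized Lebesgue measure `dμ₄(ξ, b) = dξ db / (2π)²` on `ℝ² × ℝ²`. -/
def mu4 : Measure (Plane × Plane) := ENNReal.ofReal (1 / (2 * Real.pi) ^ 2) • volume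

/-- The quaternion unit `i`. -/
def qi : ℍ[ℝ] := ⟨0, 1, 0, 0⟩

/-- The quaternion unit `j`. -/
def qj : ℍ[ℝ] := ⟨0, 0, 1, 0⟩

/-- `e^{iθ}`, the quaternion exponential of `θ i`. -/
def expI (θ : ℝ) : ℍ[ℝ] := NormedSpace.exp (θ • qi)

/-- `e^{jθ}`, the quaternion exponential of `θ j`. -/
def expJ (θ : ℝ) : ℍ[ℝ] := NormedSpace.exp (θ • qj)

/-- The two-sided quaternion Fourier transform
`F_Q(f)(u, v) = ∫ e^{-i x u} f(x, y) e^{-j y v} dμ₂(x, y)`, for integrable `f`. -/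
def qFourier (f : Plane → ℍ[ℝ]) (w : Plane) : ℍ[ℝ] :=
  ∫ x, expI (-(x.1 * w.1)) * f x * expJ (-(x.2 * w.2)) ∂mu2

/-- The action `A_ξ x = (ξ₁ x₁, ξ₂ x₂)` of the matrix `A_ξ = diag(ξ₁, ξ₂)`. -/
def dilate (ξ x : Plane) : Plane := (ξ.1 * x.1, ξ.2 * x.2)

/-- The determinant `ξ₁ ξ₂` of `A_ξ = diag(ξ₁, ξ₂)`. -/
def detA (ξ : Plane) : ℝ := ξ.1 * ξ.2

theorem detA_eq_det (ξ : Plane) : detA ξ = (Matrix.diagonal ![ξ.1, ξ.2]).det := by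
  simp [detA, Matrix.det_diagonal]

/-- The integrand `|F_Q(φ̄)(1 - ξ)|² / |det A_ξ|` of the admissibility constant; here `φ̄` is the
pointwise quaternion conjugate of `φ` and `1` is the vector `(1, 1)`. -/
def admIntegrand (φ : Plane → ℍ[ℝ]) (ξ : Plane) : ℝ :=
  ‖qFourier (fun x => star (φ x)) (1 - ξ)‖ ^ 2 / |detA ξ|

/-- The admissibility constant `C_φ`. -/
def admConst (φ : Plane → ℍ[ℝ]) : ℝ := ∫ ξ, admIntegrand φ ξ ∂mu2

/-- Admissible quaternion windows: nonzero elements of `L¹ ∩ L²` for which `C_φ` is finite and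
positive. -/
structure IsAdmissible (φ : Plane → ℍ[ℝ]) : Prop where
  memLp_one : MemLp φ 1 mu2
  memLp_two : MemLp φ 2 mu2
  ne_zero : ¬ φ =ᵐ[mu2] 0
  integrable : Integrable (admIntegrand φ) mu2
  pos : 0 < admConst φ

/-- The commutation hypothesis on a window `g` (needed for the quaternion convolution theorem):
`F_Q(g)(u,v) e^{-jvy} = e^{-jvy} F_Q(g)(u,v)` and `F_Q(jg)(u,v) e^{-jvy} = j e^{-jvy} F_Q(g)(u,v)`
for all real `u, v, y`. -/
def CommutationHyp (g : Plane → ℍ[ℝ]) : Prop :=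
  ∀ u v y : ℝ,
    qFourier g (u, v) * expJ (-(v * y)) = expJ (-(v * y)) * qFourier g (u, v) ∧
    qFourier (fun x => qj * g x) (u, v) * expJ (-(v * y)) =
      qj * expJ (-(v * y)) * qFourier g (u, v)

/-- The quaternion Stockwell transform
`(S_φ f)(ξ, b) = |det A_ξ|^{1/2} ∫ e^{-i x₁ ξ₁} f(x) e^{-j x₂ ξ₂} conj(φ(A_ξ (x - b))) dμ₂(x)`. -/
def stockwell (φ f : Plane → ℍ[ℝ]) (z : Plane × Plane) : ℍ[ℝ] :=
  (|detA z.1| ^ (1 / 2 : ℝ)) •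
    ∫ x, expI (-(x.1 * z.1.1)) * f x * expJ (-(x.2 * z.1.2)) *
      star (φ (dilate z.1 (x - z.2))) ∂mu2

end

end QStockwell

namespace QStockwell

open scoped FourierTransform SchwartzMap ComplexConjugate

/-! Write `q = α + iβ` with `α, β` in `ℝ + ℝj ≅ ℂ`. The components `α + jβ` and `α - jβ`
(`plusPart`, `minusPart`) are complex linear for right multiplication by `ℝ + ℝj`, and left
multiplication by `e^{iθ}` acts on them as `e^{Iθ}` and `e^{-Iθ}`. They therefore turn the two-sided
transform into two complex Fourier transforms, the second one at the frequency reflected in its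
first coordinate.

The commutation hypothesis is rigid: by injectivity of the Fourier transform it forces the window to
be a.e. `ℝ + ℝj`-valued and even in `x₁` (`CommutationHyp.exists_embedJ`). For such a window the
quaternion Stockwell transform splits into two complex ones.

In the complex case, for fixed `ξ` the transform is a convolution in `b`. Plancherel and the
invariance of `dξ / |det A_ξ|` under `ξ ↦ w / ξ` give `‖S f‖₂² = C ‖f‖₂²` on `L¹ ∩ L²`, and
truncation with Fatou gives `≤` on `L²`. Recombining the components yields `‖S f‖₂² ≤ C_φ ‖f‖₂²`.
Cauchy–Schwarz gives the pointwise bound `|S f| ≤ ‖φ‖₂ ‖f‖₂`, and `|S|^p = |S|^{p-2} |S|²`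
interpolates between the two. -/

/-! ### Plancherel for the Fourier integral on `L¹ ∩ L²` -/

theorem fourier_ae_eq_Lp_fourier {E : Type*} [NormedAddCommGroup E] [InnerProductSpace ℝ E]
    [FiniteDimensional ℝ E] [MeasurableSpace E] [BorelSpace E]
    {h : E → ℂ} (h1 : Integrable h) (h2 : MemLp h 2) :
    (𝓕 h : E → ℂ) =ᵐ[volume] (𝓕 (h2.toLp h) : Lp ℂ 2 (volume : Measure E)) := by
  set G : Lp ℂ 2 (volume : Measure E) := 𝓕 (h2.toLp h) with hG
  have hcont : Continuous (𝓕 h : E → ℂ) :=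
    VectorFourier.fourierIntegral_continuous Real.continuous_fourierChar
      (by exact continuous_inner) h1
  have l1 : LocallyIntegrable (𝓕 h : E → ℂ) := hcont.locallyIntegrable
  have l2 : LocallyIntegrable (G : E → ℂ) := (Lp.memLp G).locallyIntegrable (by norm_num)
  -- Both functions pair with a test function `g` to `∫ ĝ h`: one by the multiplication formula, the
  -- other because the `L²` transform agrees with the distributional one.
  have key := ae_eq_zero_of_integral_contDiff_smul_eq_zero (l1.sub l2) (fun g hg hgc => by
    have hc : HasCompactSupport (fun x => (g x : ℂ)) := hgc.comp_left (g := Complex.ofReal) rfl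
    have hd : ContDiff ℝ ((⊤ : ℕ∞) : WithTop ℕ∞) (fun x => (g x : ℂ)) :=
      Complex.ofRealCLM.contDiff.comp hg
    set s : 𝓢(E, ℂ) := hc.toSchwartzMap hd with hs
    have hsx : ∀ x, s x = g x := fun x => rfl
    have e1 : ∫ x, g x • (𝓕 h : E → ℂ) x = ∫ x, (𝓕 s) x • h x := by
      have := VectorFourier.integral_fourierIntegral_smul_eq_flip (μ := (volume : Measure E))
        (ν := (volume : Measure E)) (L := innerₗ E) (e := Real.fourierChar) (f := s) (g := h)
        Real.continuous_fourierChar (by exact continuous_inner) s.integrable h1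
      rw [flip_innerₗ] at this
      rw [SchwartzMap.fourier_coe]
      simp only [Complex.real_smul, ← hsx]
      exact this.symm
    have e2 : ∫ x, g x • G x = ∫ x, (𝓕 s) x • h x := by
      have := congrArg (fun T => T s) (Lp.fourier_toTemperedDistribution_eq (h2.toLp h))
      simp only [TemperedDistribution.fourier_apply, Lp.toTemperedDistribution_apply] at this
      simp only [Complex.real_smul, ← hsx]
      rw [← hG] at this
      refine this.symm.trans (integral_congr_ae ?_)
      filter_upwards [h2.coeFn_toLp] with x hx
      rw [hx]
    simp only [Pi.sub_apply, smul_sub]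
    rw [integral_sub, e1, e2, sub_self]
    · exact l1.integrable_smul_left_of_hasCompactSupport hg.continuous hgc
    · exact l2.integrable_smul_left_of_hasCompactSupport hg.continuous hgc)
  filter_upwards [key] with x hx
  exact sub_eq_zero.mp hx

theorem eLpNorm_fourier_eq {E : Type*} [NormedAddCommGroup E] [InnerProductSpace ℝ E]
    [FiniteDimensional ℝ E] [MeasurableSpace E] [BorelSpace E]
    {h : E → ℂ} (h1 : Integrable h) (h2 : MemLp h 2) :
    eLpNorm (𝓕 h : E → ℂ) 2 volume = eLpNorm h 2 volume := by
  rw [eLpNorm_congr_ae (fourier_ae_eq_Lp_fourier h1 h2), ← Lp.enorm_def, ← ofReal_norm,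
    Lp.norm_fourier_eq, ofReal_norm, Lp.enorm_def, eLpNorm_congr_ae h2.coeFn_toLp]

theorem lintegral_enorm_fourier_sq {E : Type*} [NormedAddCommGroup E] [InnerProductSpace ℝ E]
    [FiniteDimensional ℝ E] [MeasurableSpace E] [BorelSpace E]
    {h : E → ℂ} (h1 : Integrable h) (h2 : MemLp h 2) :
    ∫⁻ w, ‖(𝓕 h : E → ℂ) w‖ₑ ^ 2 = ∫⁻ x, ‖h x‖ₑ ^ 2 := by
  have := eLpNorm_fourier_eq h1 h2
  have e : ∀ g : E → ℂ, ∫⁻ w, ‖g w‖ₑ ^ 2 = eLpNorm g 2 volume ^ 2 := fun g => by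
    have := eLpNorm_nnreal_pow_eq_lintegral (μ := (volume : Measure E)) (f := g) (p := 2) two_ne_zero
    simpa using this.symm
  rw [e, e, this]

/-! ### Fourier transform and convolution on the plane, normalized by `mu2` -/

/-- The complex Fourier transform on the plane with the unitary normalization of `mu2`. -/
noncomputable def planeFourier (h : Plane → ℂ) (w : Plane) : ℂ :=
  ∫ x, Complex.exp (-(Complex.I * (x.1 * w.1 + x.2 * w.2))) * h x ∂mu2

/-- The convolution on the plane with respect to `mu2`. -/
noncomputable def planeConv (f g : Plane → ℂ) (b : Plane) : ℂ := ∫ x, f x * g (b - x) ∂mu2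

theorem ofReal_inv_two_pi_ne_zero : ENNReal.ofReal (1 / (2 * Real.pi)) ≠ 0 := by
  have := Real.pi_pos
  simp only [ne_eq, ENNReal.ofReal_eq_zero, not_le]
  positivity

theorem mu2_absolutelyContinuous_volume : mu2 ≪ (volume : Measure Plane) :=
  Measure.smul_absolutelyContinuous

instance : SigmaFinite mu2 := by
  unfold mu2
  exact SMul.sigmaFinite (μ := (volume : Measure Plane)) (Real.toNNReal (1 / (2 * Real.pi)))

instance : mu2.IsAddHaarMeasure := by
  unfold mu2
  exact Measure.IsAddHaarMeasure.smul _ ofReal_inv_two_pi_ne_zero ENNReal.ofReal_ne_top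

theorem lintegral_mu2 (F : Plane → ℝ≥0∞) :
    ∫⁻ x, F x ∂mu2 = ENNReal.ofReal (1 / (2 * Real.pi)) * ∫⁻ x, F x := by
  rw [mu2, lintegral_smul_measure, smul_eq_mul]

theorem integral_mu2 {G : Type*} [NormedAddCommGroup G] [NormedSpace ℝ G] (F : Plane → G) :
    ∫ x, F x ∂mu2 = (1 / (2 * Real.pi)) • ∫ x, F x := by
  have := Real.pi_pos
  rw [mu2, integral_smul_measure, ENNReal.toReal_ofReal (by positivity)]

theorem mu4_eq_prod : mu4 = mu2.prod mu2 := by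
  have := Real.pi_pos
  rw [mu4, mu2, Measure.prod_smul_left, Measure.prod_smul_right, smul_smul,
    ← ENNReal.ofReal_mul (by positivity), ← Measure.volume_eq_prod]
  congr 2
  field_simp

/-- `ℝ × ℝ` carries the sup norm, so Fourier theory on inner product spaces is applied on `ℂ` and
transported along this equivalence. -/
theorem integrable_comp_equivRealProd {G : Type*} [NormedAddCommGroup G] {f : Plane → G}
    (hf : Integrable f mu2) : Integrable (f ∘ Complex.measurableEquivRealProd) :=
  (Complex.volume_preserving_equiv_real_prod.integrable_comp_emb
    Complex.measurableEquivRealProd.measurableEmbedding).2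
    ((integrable_smul_measure ofReal_inv_two_pi_ne_zero ENNReal.ofReal_ne_top).1 hf)

theorem memLp_comp_equivRealProd {G : Type*} [NormedAddCommGroup G] {f : Plane → G} {p : ℝ≥0∞}
    (hf : MemLp f p mu2) : MemLp (f ∘ Complex.measurableEquivRealProd) p := by
  have hv : MemLp f p volume := by
    refine MemLp.of_measure_le_smul (c := ENNReal.ofReal (2 * Real.pi)) ENNReal.ofReal_ne_top ?_ hf
    have := Real.pi_pos
    rw [mu2, smul_smul, ← ENNReal.ofReal_mul (by positivity)]
    rw [mul_one_div_cancel (by positivity)]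
    simp
  exact hv.comp_measurePreserving Complex.volume_preserving_equiv_real_prod

theorem planeFourier_eq (h : Plane → ℂ) (w : Plane) :
    planeFourier h w = (1 / (2 * Real.pi)) •
      (𝓕 (h ∘ Complex.measurableEquivRealProd) : ℂ → ℂ)
        (Complex.measurableEquivRealProd.symm ((2 * Real.pi)⁻¹ • w)) := by
  have := Real.pi_pos
  rw [planeFourier, integral_mu2, Real.fourier_eq',
    ← Complex.volume_preserving_equiv_real_prod.integral_comp
      Complex.measurableEquivRealProd.measurableEmbedding]
  congr 1
  refine integral_congr_ae (Filter.Eventually.of_forall fun z => ?_)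
  have e1 : (Complex.measurableEquivRealProd z) = (z.re, z.im) := rfl
  have e2 : Complex.measurableEquivRealProd.symm ((2 * Real.pi)⁻¹ • w) =
    ⟨(2 * Real.pi)⁻¹ * w.1, (2 * Real.pi)⁻¹ * w.2⟩ := rfl
  simp only [Function.comp, e1, e2, smul_eq_mul, Complex.inner, Complex.mul_re, Complex.conj_re,
    Complex.conj_im]
  congr 2
  push_cast
  field_simp
  ring

theorem continuous_planeFourier {h : Plane → ℂ} (h1 : Integrable h mu2) :
    Continuous (planeFourier h) := by
  have hc : Continuous (𝓕 (h ∘ Complex.measurableEquivRealProd) : ℂ → ℂ) :=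
    VectorFourier.fourierIntegral_continuous Real.continuous_fourierChar
      (by exact continuous_inner) (integrable_comp_equivRealProd h1)
  have he : Continuous (Complex.measurableEquivRealProd.symm) :=
    Complex.equivRealProdCLM.symm.continuous
  have : planeFourier h = fun w => (1 / (2 * Real.pi)) •
      (𝓕 (h ∘ Complex.measurableEquivRealProd) : ℂ → ℂ)
        (Complex.measurableEquivRealProd.symm ((2 * Real.pi)⁻¹ • w)) :=
    funext (planeFourier_eq h)
  rw [this]
  exact (hc.comp (he.comp (continuous_const_smul ((2 * Real.pi)⁻¹ : ℝ)))).const_smul (1 / (2 * Real.pi) : ℝ)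

/-- The frequency scaling by `1 / 2π` in two dimensions contributes `(2π)²`, which cancels the
squared prefactor `1 / 2π`. -/
theorem lintegral_enorm_planeFourier_sq {h : Plane → ℂ} (h1 : Integrable h mu2)
    (h2 : MemLp h 2 mu2) :
    ∫⁻ w, ‖planeFourier h w‖ₑ ^ 2 ∂mu2 = ∫⁻ x, ‖h x‖ₑ ^ 2 ∂mu2 := by
  have hpi := Real.pi_pos
  set F : ℂ → ℂ := 𝓕 (h ∘ Complex.measurableEquivRealProd) with hF
  have hFc : Continuous F := VectorFourier.fourierIntegral_continuous Real.continuous_fourierChar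
      (by exact continuous_inner) (integrable_comp_equivRealProd h1)
  have hPl : ∫⁻ z, ‖F z‖ₑ ^ 2 = ∫⁻ x, ‖h x‖ₑ ^ 2 := by
    rw [lintegral_enorm_fourier_sq (integrable_comp_equivRealProd h1)
      (memLp_comp_equivRealProd h2),
      ← Complex.volume_preserving_equiv_real_prod.lintegral_comp_emb
        Complex.measurableEquivRealProd.measurableEmbedding]
    rfl
  have hsc : ∫⁻ w : Plane, ‖F (Complex.measurableEquivRealProd.symm ((2 * Real.pi)⁻¹ • w))‖ₑ ^ 2 =
      ENNReal.ofReal ((2 * Real.pi) ^ 2) * ∫⁻ z, ‖F z‖ₑ ^ 2 := by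
    have hm : Measurable fun v : Plane => ‖F (Complex.measurableEquivRealProd.symm v)‖ₑ ^ 2 :=
      ((hFc.measurable.comp Complex.measurableEquivRealProd.symm.measurable).enorm).pow_const 2
    have := Measure.map_addHaar_smul (volume : Measure Plane)
      (r := (2 * Real.pi)⁻¹) (by positivity)
    rw [← lintegral_map hm (measurable_const_smul ((2 * Real.pi)⁻¹)), this,
      lintegral_smul_measure, smul_eq_mul,
      ← (Complex.volume_preserving_equiv_real_prod.symm).lintegral_comp_emb
        Complex.measurableEquivRealProd.symm.measurableEmbedding]
    congr 2
    simp only [Module.finrank_prod, Module.finrank_self, Nat.reduceAdd]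
    rw [abs_of_pos (by positivity)]
    field_simp
  rw [lintegral_mu2, lintegral_mu2, ← hPl]
  simp_rw [planeFourier_eq, enorm_smul, mul_pow]
  rw [lintegral_const_mul' _ _ (ENNReal.pow_ne_top enorm_ne_top), hsc, ← mul_assoc (‖_‖ₑ ^ 2), Real.enorm_eq_ofReal_abs,
    ← ENNReal.ofReal_pow (by positivity), ← ENNReal.ofReal_mul (by positivity), abs_of_pos (by positivity),
    ← mul_pow, one_div_mul_cancel (by positivity)]
  simp

theorem planeConv_comp (f g : Plane → ℂ) :
    planeConv f g ∘ Complex.measurableEquivRealProd = fun z => (1 / (2 * Real.pi) : ℝ) •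
      convolution (f ∘ Complex.measurableEquivRealProd) (g ∘ Complex.measurableEquivRealProd)
        (ContinuousLinearMap.mul ℂ ℂ) volume z := by
  funext z
  rw [Function.comp, planeConv, integral_mu2, convolution,
    ← Complex.volume_preserving_equiv_real_prod.integral_comp
      Complex.measurableEquivRealProd.measurableEmbedding]
  rfl

theorem planeFourier_planeConv {f g : Plane → ℂ} (hf : Integrable f mu2) (hg : Integrable g mu2)
    (w : Plane) : planeFourier (planeConv f g) w = planeFourier f w * planeFourier g w := by
  simp only [planeFourier_eq, planeConv_comp]
  have := Real.fourier_mul_convolution_eq (integrable_comp_equivRealProd hf)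
    (integrable_comp_equivRealProd hg)
    (Complex.measurableEquivRealProd.symm ((2 * Real.pi)⁻¹ • w))
  rw [smul_mul_smul_comm, ← this, Real.fourier_eq, Real.fourier_eq, mul_smul]
  congr 1
  rw [← integral_smul]
  refine integral_congr_ae (Filter.Eventually.of_forall fun v => ?_)
  simp only [Circle.smul_def]
  rw [smul_comm]

theorem enorm_integral_mul_le {α A : Type*} [MeasurableSpace α] {μ : Measure α} [NormedRing A]
    [NormedSpace ℝ A] {f g : α → A} (hf : AEStronglyMeasurable f μ)
    (hg : AEStronglyMeasurable g μ) :
    ‖∫ x, f x * g x ∂μ‖ₑ ≤ eLpNorm f 2 μ * eLpNorm g 2 μ := by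
  refine (enorm_integral_le_lintegral_enorm _).trans ?_
  rw [← eLpNorm_one_eq_lintegral_enorm]
  simpa using eLpNorm_le_eLpNorm_mul_eLpNorm_of_nnnorm (p := 2) (q := 2) (r := 1) hf hg
    (fun a b => a * b) 1 (Filter.Eventually.of_forall fun x => by simpa using nnnorm_mul_le _ _)

theorem lintegral_enorm_sq_eq {α G : Type*} [MeasurableSpace α] [NormedAddCommGroup G]
    {μ : Measure α} (f : α → G) : ∫⁻ x, ‖f x‖ₑ ^ 2 ∂μ = eLpNorm f 2 μ ^ 2 := by
  have := eLpNorm_nnreal_pow_eq_lintegral (μ := μ) (f := f) (p := 2) two_ne_zero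
  simpa using this.symm

theorem memLp_two_of_integrable_of_bounded {α : Type*} [MeasurableSpace α] {μ : Measure α}
    {h : α → ℂ} (h1 : Integrable h μ) {M : ℝ} (hM : ∀ x, ‖h x‖ ≤ M) : MemLp h 2 μ := by
  rw [memLp_two_iff_integrable_sq_norm h1.aestronglyMeasurable]
  simp_rw [sq]
  exact h1.norm.bdd_mul (c := M) h1.norm.aestronglyMeasurable
    (Filter.Eventually.of_forall fun x => by simpa using hM x)

/-- The convolution is integrable, and bounded by Cauchy–Schwarz, hence in `L²`; Plancherel and the
convolution theorem then apply. -/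
theorem lintegral_enorm_planeConv_sq {f g : Plane → ℂ} (hf1 : Integrable f mu2)
    (hf2 : MemLp f 2 mu2) (hg1 : Integrable g mu2) (hg2 : MemLp g 2 mu2) :
    ∫⁻ b, ‖planeConv f g b‖ₑ ^ 2 ∂mu2 =
      ∫⁻ w, ‖planeFourier f w‖ₑ ^ 2 * ‖planeFourier g w‖ₑ ^ 2 ∂mu2 := by
  have hi : Integrable (planeConv f g) mu2 :=
    hf1.integrable_convolution (ContinuousLinearMap.mul ℂ ℂ) hg1
  have hb : ∀ b, ‖planeConv f g b‖ ≤ (eLpNorm f 2 mu2 * eLpNorm g 2 mu2).toReal := fun b => by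
    have hp := Measure.measurePreserving_sub_left mu2 b
    have h := enorm_integral_mul_le (μ := mu2) hf2.1 (hg2.comp_measurePreserving hp).1
    rw [eLpNorm_comp_measurePreserving hg2.1 hp] at h
    rw [← toReal_enorm]
    exact ENNReal.toReal_mono (ENNReal.mul_ne_top hf2.eLpNorm_ne_top hg2.eLpNorm_ne_top) h
  rw [← lintegral_enorm_planeFourier_sq hi (memLp_two_of_integrable_of_bounded hi hb)]
  simp_rw [planeFourier_planeConv hf1 hg1, enorm_mul, mul_pow]

/-! ### Modulations and dilations -/

/-- The character `x ↦ exp (-i x · ξ)` of the plane. -/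
noncomputable def planeChar (ξ x : Plane) : ℂ :=
  Complex.exp (-(Complex.I * (x.1 * ξ.1 + x.2 * ξ.2)))

theorem norm_planeChar (ξ x : Plane) : ‖planeChar ξ x‖ = 1 := by
  have : planeChar ξ x = Complex.exp ((-(x.1 * ξ.1 + x.2 * ξ.2) : ℝ) * Complex.I) := by
    rw [planeChar]; push_cast; ring_nf
  rw [this, Complex.norm_exp_ofReal_mul_I]

theorem continuous_planeChar (ξ : Plane) : Continuous (planeChar ξ) := by
  unfold planeChar; fun_prop

theorem memLp_planeChar_mul {f : Plane → ℂ} {p : ℝ≥0∞} (ξ : Plane) (hf : MemLp f p mu2) :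
    MemLp (fun x => planeChar ξ x * f x) p mu2 :=
  hf.of_le ((continuous_planeChar ξ).aestronglyMeasurable.mul hf.1)
    (Filter.Eventually.of_forall fun x => by simp [norm_planeChar])

theorem planeFourier_planeChar_mul (f : Plane → ℂ) (ξ w : Plane) :
    planeFourier (fun x => planeChar ξ x * f x) w = planeFourier f (w + ξ) := by
  refine integral_congr_ae (Filter.Eventually.of_forall fun x => ?_)
  simp only [planeChar, ← mul_assoc, ← Complex.exp_add, Prod.fst_add, Prod.snd_add]
  congr 2
  push_cast
  ring

theorem measurable_dilate (ξ : Plane) : Measurable (dilate ξ) := by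
  unfold dilate; fun_prop

theorem measurableEmbedding_dilate {ξ : Plane} (h1 : ξ.1 ≠ 0) (h2 : ξ.2 ≠ 0) :
    MeasurableEmbedding (dilate ξ) :=
  ((Homeomorph.mulLeft₀ ξ.1 h1).prodCongr (Homeomorph.mulLeft₀ ξ.2 h2)).measurableEmbedding

theorem map_dilate_mu2 {ξ : Plane} (h1 : ξ.1 ≠ 0) (h2 : ξ.2 ≠ 0) :
    mu2.map (dilate ξ) = ENNReal.ofReal |detA ξ|⁻¹ • mu2 := by
  have e : dilate ξ = Prod.map (fun x => ξ.1 * x) (fun x => ξ.2 * x) := rfl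
  rw [mu2, Measure.map_smul, smul_comm]
  congr 1
  rw [e, Measure.volume_eq_prod, ← Measure.map_prod_map _ _ (by fun_prop) (by fun_prop),
    Real.map_volume_mul_left h1, Real.map_volume_mul_left h2, Measure.prod_smul_left,
    Measure.prod_smul_right, smul_smul, ← ENNReal.ofReal_mul (by positivity), ← abs_mul,
    ← mul_inv, abs_inv, detA]

theorem memLp_comp_dilate {G : Type*} [NormedAddCommGroup G] {g : Plane → G} {p : ℝ≥0∞}
    {ξ : Plane} (h1 : ξ.1 ≠ 0) (h2 : ξ.2 ≠ 0) (hg : MemLp g p mu2) :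
    MemLp (fun x => g (dilate ξ x)) p mu2 := by
  refine (measurableEmbedding_dilate h1 h2).memLp_map_measure_iff.1 ?_
  rw [map_dilate_mu2 h1 h2]
  exact hg.smul_measure ENNReal.ofReal_ne_top

theorem eLpNorm_two_comp_dilate {G : Type*} [NormedAddCommGroup G] (g : Plane → G)
    {ξ : Plane} (h1 : ξ.1 ≠ 0) (h2 : ξ.2 ≠ 0) :
    ENNReal.ofReal (|detA ξ| ^ (1 / 2 : ℝ)) * eLpNorm (fun x => g (dilate ξ x)) 2 mu2 =
      eLpNorm g 2 mu2 := by
  have hd : 0 < |detA ξ| := abs_pos.2 (mul_ne_zero h1 h2)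
  have := (measurableEmbedding_dilate h1 h2).eLpNorm_map_measure (μ := mu2) (g := g) (p := 2)
  change _ * eLpNorm (g ∘ dilate ξ) 2 mu2 = _
  rw [← this, map_dilate_mu2 h1 h2, eLpNorm_smul_measure_of_ne_top (by simp), smul_eq_mul,
    ← mul_assoc, ENNReal.ofReal_rpow_of_pos (by positivity), ← ENNReal.ofReal_mul (by positivity)]
  simp only [one_div, ENNReal.toReal_inv, ENNReal.toReal_ofNat]
  rw [Real.inv_rpow hd.le, mul_inv_cancel₀ (by positivity)]
  simp

theorem planeFourier_comp_dilate (g : Plane → ℂ) {ξ : Plane} (h1 : ξ.1 ≠ 0) (h2 : ξ.2 ≠ 0)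
    (w : Plane) : planeFourier (fun x => g (dilate ξ x)) w =
      |detA ξ|⁻¹ • planeFourier g (w.1 / ξ.1, w.2 / ξ.2) := by
  have h := (measurableEmbedding_dilate h1 h2).integral_map (μ := mu2)
    (fun y => planeChar (w.1 / ξ.1, w.2 / ξ.2) y * g y)
  rw [map_dilate_mu2 h1 h2, integral_smul_measure, ENNReal.toReal_ofReal (by positivity)] at h
  refine Eq.trans ?_ h.symm
  refine integral_congr_ae (Filter.Eventually.of_forall fun x => ?_)
  have h1' : (ξ.1 : ℂ) ≠ 0 := by exact_mod_cast h1
  have h2' : (ξ.2 : ℂ) ≠ 0 := by exact_mod_cast h2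
  simp only [planeChar, dilate]
  congr 4
  push_cast
  field_simp

/-- `dx / |x|` is the Haar measure of the multiplicative group `ℝ \ {0}`, so inversion and scaling
preserve it; the omitted point is null. -/
theorem lintegral_comp_div_mul_inv_abs (G : ℝ → ℝ≥0∞) {a : ℝ} (ha : a ≠ 0) :
    ∫⁻ x, G (a / x) * ENNReal.ofReal |x|⁻¹ = ∫⁻ x, G x * ENNReal.ofReal |x|⁻¹ := by
  have hae : ∀ F : ℝ → ℝ≥0∞, ∫⁻ x, F x = ∫⁻ x in {0}ᶜ, F x := fun F => by
    
    rw [Measure.restrict_eq_self_of_ae_mem]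
    exact compl_mem_ae_iff.2 (measure_singleton 0)
  have him : (fun x => a / x) '' {0}ᶜ = {0}ᶜ := by
    ext y
    constructor
    · rintro ⟨x, hx, rfl⟩
      exact div_ne_zero ha hx
    · intro hy
      have hy' : y ≠ 0 := hy
      exact ⟨a / y, div_ne_zero ha hy', by field_simp⟩
  have h := lintegral_image_eq_lintegral_abs_deriv_mul (s := {0}ᶜ) (f := fun x => a / x)
    (f' := fun x => -a / x ^ 2) (measurableSet_singleton 0).compl
    (fun x hx => by
      have := ((hasDerivAt_const x a).div (hasDerivAt_id x) hx).hasDerivWithinAt (s := {0}ᶜ)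
      convert! this using 1
      simp)
    (fun x hx y hy hxy => by
      have hx' : x ≠ 0 := hx
      have hy' : y ≠ 0 := hy
      have hxy' : a / x = a / y := hxy
      field_simp at hxy'
      exact hxy'.symm)
    (fun x => G x * ENNReal.ofReal |x|⁻¹)
  rw [him] at h
  rw [hae, hae, h]
  refine setLIntegral_congr_fun (measurableSet_singleton 0).compl fun x hx => ?_
  have hx' : x ≠ 0 := hx
  have : |x|⁻¹ = |-a / x ^ 2| * |a / x|⁻¹ := by
    rw [abs_div, abs_div, abs_neg, abs_pow]
    have := abs_pos.2 ha
    have := abs_pos.2 hx'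
    field_simp
  change _ = ENNReal.ofReal |-a / x ^ 2| * (G (a / x) * ENNReal.ofReal |a / x|⁻¹)
  rw [this, ENNReal.ofReal_mul (by positivity)]
  ring

theorem lintegral_plane_comp_div_mul_inv_abs_detA {G : Plane → ℝ≥0∞} (hG : Measurable G)
    {w : Plane} (h1 : w.1 ≠ 0) (h2 : w.2 ≠ 0) :
    ∫⁻ ξ, G (w.1 / ξ.1, w.2 / ξ.2) * ENNReal.ofReal |detA ξ|⁻¹ ∂mu2 =
      ∫⁻ ξ, G ξ * ENNReal.ofReal |detA ξ|⁻¹ ∂mu2 := by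
  have e : ∀ a b : ℝ, ENNReal.ofReal |detA (a, b)|⁻¹ =
      ENNReal.ofReal |b|⁻¹ * ENNReal.ofReal |a|⁻¹ := fun a b => by
    rw [← ENNReal.ofReal_mul (by positivity), detA, abs_mul, mul_inv, mul_comm]
  have hd : Measurable fun ξ : Plane => ENNReal.ofReal |detA ξ|⁻¹ := by
    unfold detA; fun_prop
  rw [lintegral_mu2, lintegral_mu2, Measure.volume_eq_prod,
    lintegral_prod _ (by fun_prop), lintegral_prod _ (by fun_prop)]
  congr 1
  simp only [e, ← mul_assoc]
  have hx : ∀ x : ℝ, ∀ F : ℝ → ℝ≥0∞, ∫⁻ y, F y * ENNReal.ofReal |x|⁻¹ =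
      (∫⁻ y, F y) * ENNReal.ofReal |x|⁻¹ := fun x F =>
    lintegral_mul_const' _ _ ENNReal.ofReal_ne_top
  simp only [hx]
  rw [lintegral_comp_div_mul_inv_abs
    (fun x => ∫⁻ y, G (x, w.2 / y) * ENNReal.ofReal |y|⁻¹) h1]
  refine lintegral_congr fun x => ?_
  rw [lintegral_comp_div_mul_inv_abs (fun y => G (x, y)) h2]

/-! ### The complex Stockwell transform and its `L²` bound -/

/-- The Stockwell transform of complex functions on the plane. -/
noncomputable def planeStockwell (φ f : Plane → ℂ) (z : Plane × Plane) : ℂ :=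
  (|detA z.1| ^ (1 / 2 : ℝ)) •
    ∫ x, planeChar z.1 x * f x * conj (φ (dilate z.1 (x - z.2))) ∂mu2

/-- The admissibility constant of a complex window, as an extended nonnegative real. -/
noncomputable def planeAdm (φ : Plane → ℂ) : ℝ≥0∞ :=
  ∫⁻ ξ, ‖planeFourier (fun x => conj (φ x)) (1 - ξ)‖ₑ ^ 2 * ENNReal.ofReal |detA ξ|⁻¹ ∂mu2

theorem memLp_conj {α : Type*} [MeasurableSpace α] {μ : Measure α} {g : α → ℂ} {p : ℝ≥0∞}
    (hg : MemLp g p μ) : MemLp (fun x => conj (g x)) p μ :=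
  hg.of_le (Complex.continuous_conj.comp_aestronglyMeasurable hg.1)
    (Filter.Eventually.of_forall fun x => by simp)

/-- Since `A_ξ(x - b) = A_{-ξ}(b - x)`, the slice is a convolution of the modulated `f` with a
dilate of the conjugate window. Modulation shifts the frequency of `f` by `ξ`; undoing this by
translation turns the window's argument into `(w - ξ) / (-ξ) = 1 - w / ξ`, the origin of the `1 - ξ`
in the admissibility constant. -/
theorem lintegral_enorm_planeStockwell_sq_slice {φ f : Plane → ℂ} (hf1 : MemLp f 1 mu2)
    (hf2 : MemLp f 2 mu2) (hφ1 : MemLp φ 1 mu2) (hφ2 : MemLp φ 2 mu2) (ξ : Plane) :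
    ∫⁻ b, ‖planeStockwell φ f (ξ, b)‖ₑ ^ 2 ∂mu2 =
      ∫⁻ w, ‖planeFourier f w‖ₑ ^ 2 *
        (‖planeFourier (fun x => conj (φ x)) (1 - (w.1 / ξ.1, w.2 / ξ.2))‖ₑ ^ 2 *
          ENNReal.ofReal |detA ξ|⁻¹) ∂mu2 := by
  by_cases hd : detA ξ = 0
  -- Both sides vanish here, the right one because `0⁻¹ = 0`.
  · simp [planeStockwell, hd]
  have h1 : ξ.1 ≠ 0 := left_ne_zero_of_mul hd
  have h2 : ξ.2 ≠ 0 := right_ne_zero_of_mul hd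
  have h1' : (-ξ).1 ≠ 0 := neg_ne_zero.2 h1
  have h2' : (-ξ).2 ≠ 0 := neg_ne_zero.2 h2
  have hdn : detA (-ξ) = detA ξ := by simp [detA]
  have hpos : 0 < |detA ξ| := abs_pos.2 hd
  set g : Plane → ℂ := fun x => conj (φ x) with hg
  have hg1 : MemLp g 1 mu2 := memLp_conj hφ1
  have hg2 : MemLp g 2 mu2 := memLp_conj hφ2
  have hT : ∀ b, planeStockwell φ f (ξ, b) = (|detA ξ| ^ (1 / 2 : ℝ)) •
      planeConv (fun x => planeChar ξ x * f x) (fun y => g (dilate (-ξ) y)) b := fun b => by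
    simp only [planeStockwell, planeConv, hg]
    congr 1
    refine integral_congr_ae (Filter.Eventually.of_forall fun x => ?_)
    have : dilate (-ξ) (b - x) = dilate ξ (x - b) := by
      ext <;> simp [dilate] <;> ring
    simp only [this]
  have hc := lintegral_enorm_planeConv_sq (memLp_one_iff_integrable.1 (memLp_planeChar_mul ξ hf1))
    (memLp_planeChar_mul ξ hf2)
    (memLp_one_iff_integrable.1 (memLp_comp_dilate h1' h2' hg1))
    (memLp_comp_dilate h1' h2' hg2)
  simp_rw [hT, enorm_smul, mul_pow]
  rw [lintegral_const_mul' _ _ (ENNReal.pow_ne_top enorm_ne_top), hc]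
  simp_rw [planeFourier_planeChar_mul]
  simp_rw [planeFourier_comp_dilate g h1' h2', hdn, enorm_smul, mul_pow]
  rw [← lintegral_const_mul' _ _ (ENNReal.pow_ne_top enorm_ne_top),
    ← lintegral_sub_right_eq_self _ ξ]
  refine lintegral_congr fun w => ?_
  have e1 : w - ξ + ξ = w := sub_add_cancel _ _
  have e2 : (((w - ξ).1 / (-ξ).1, (w - ξ).2 / (-ξ).2) : Plane) =
      1 - (w.1 / ξ.1, w.2 / ξ.2) := by
    ext <;> simp <;> field_simp <;> ring
  have e3 : ‖|detA ξ| ^ (1 / 2 : ℝ)‖ₑ ^ 2 * ‖|detA ξ|⁻¹‖ₑ ^ 2 = ENNReal.ofReal |detA ξ|⁻¹ := by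
    rw [Real.enorm_of_nonneg (by positivity), Real.enorm_of_nonneg (by positivity), ← mul_pow,
      ← ENNReal.ofReal_mul (by positivity), ← ENNReal.ofReal_pow (by positivity)]
    congr 1
    rw [mul_pow, ← Real.rpow_natCast (_ ^ _), ← Real.rpow_mul hpos.le]
    norm_num
    field_simp
    exact sq_abs _
  rw [e1, e2, ← e3]
  ring

theorem measurable_planeFourier {h : Plane → ℂ} (h1 : MemLp h 1 mu2) :
    Measurable (planeFourier h) :=
  (continuous_planeFourier (memLp_one_iff_integrable.1 h1)).measurable

theorem ae_mu2_coord_ne_zero : ∀ᵐ w : Plane ∂mu2, w.1 ≠ 0 ∧ w.2 ≠ 0 := by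
  refine mu2_absolutelyContinuous_volume.ae_le ?_
  rw [Measure.volume_eq_prod]
  have h0 : ∀ᵐ x : ℝ, x ≠ 0 := compl_mem_ae_iff.2 (measure_singleton 0)
  exact (Measure.quasiMeasurePreserving_fst.ae h0).and
    (Measure.quasiMeasurePreserving_snd.ae h0)

/-- After exchanging the integrals in `ξ` and `w`, the inner one is independent of `w` off the
coordinate axes, by the substitution `ξ ↦ w / ξ`, and equals `planeAdm φ`. -/
theorem lintegral_enorm_planeStockwell_sq {φ f : Plane → ℂ} (hf1 : MemLp f 1 mu2)
    (hf2 : MemLp f 2 mu2) (hφ1 : MemLp φ 1 mu2) (hφ2 : MemLp φ 2 mu2) :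
    ∫⁻ ξ, ∫⁻ b, ‖planeStockwell φ f (ξ, b)‖ₑ ^ 2 ∂mu2 ∂mu2 =
      planeAdm φ * ∫⁻ x, ‖f x‖ₑ ^ 2 ∂mu2 := by
  have hF : Measurable (planeFourier f) := measurable_planeFourier hf1
  have hG : Measurable (planeFourier fun x => conj (φ x)) :=
    measurable_planeFourier (memLp_conj hφ1)
  have hd : Measurable fun ξ : Plane => ENNReal.ofReal |detA ξ|⁻¹ := by
    unfold detA; fun_prop
  simp_rw [lintegral_enorm_planeStockwell_sq_slice hf1 hf2 hφ1 hφ2]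
  rw [lintegral_lintegral_swap (by
    refine Measurable.aemeasurable ?_
    simp only [Function.uncurry_def]
    refine ((hF.comp measurable_snd).enorm.pow_const 2).mul
      (((hG.comp ?_).enorm.pow_const 2).mul (hd.comp measurable_fst))
    fun_prop)]
  have hm : Measurable fun ξ : Plane => ‖planeFourier (fun x => conj (φ x)) (1 - ξ)‖ₑ ^ 2 :=
    (hG.comp (measurable_const.sub measurable_id)).enorm.pow_const 2
  rw [← lintegral_enorm_planeFourier_sq (memLp_one_iff_integrable.1 hf1) hf2,
    ← lintegral_const_mul _ (hF.enorm.pow_const 2)]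
  refine lintegral_congr_ae ?_
  filter_upwards [ae_mu2_coord_ne_zero] with w hw
  rw [lintegral_const_mul' _ _ (ENNReal.pow_ne_top enorm_ne_top),
    lintegral_plane_comp_div_mul_inv_abs_detA hm hw.1 hw.2, mul_comm]
  rfl

theorem stronglyMeasurable_planeStockwell {φ f : Plane → ℂ} (hφ : Measurable φ)
    (hf : Measurable f) : StronglyMeasurable (planeStockwell φ f) := by
  have h1 : StronglyMeasurable fun z : Plane × Plane => |detA z.1| ^ (1 / 2 : ℝ) := by
    refine Measurable.stronglyMeasurable ?_
    unfold detA; fun_prop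
  have h2 : StronglyMeasurable fun q : (Plane × Plane) × Plane =>
      planeChar q.1.1 q.2 * f q.2 * conj (φ (dilate q.1.1 (q.2 - q.1.2))) := by
    refine Measurable.stronglyMeasurable ?_
    unfold planeChar dilate
    refine ((Measurable.mul ?_ (by fun_prop))).mul
      (Complex.continuous_conj.measurable.comp (hφ.comp ?_)) <;> fun_prop
  exact h1.smul (h2.integral_prod_right' (ν := mu2))

theorem integrable_planeStockwell_integrand {φ f : Plane → ℂ} (hf2 : MemLp f 2 mu2)
    (hφ2 : MemLp φ 2 mu2) {ξ : Plane} (hd : detA ξ ≠ 0) (b : Plane) :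
    Integrable (fun x => planeChar ξ x * f x * conj (φ (dilate ξ (x - b)))) mu2 :=
  (memLp_planeChar_mul ξ hf2).integrable_mul
    ((memLp_conj (memLp_comp_dilate (left_ne_zero_of_mul hd) (right_ne_zero_of_mul hd)
      hφ2)).comp_measurePreserving (measurePreserving_sub_right mu2 b))

/-- Truncations of `f` to balls lie in `L¹ ∩ L²`, where the identity holds. Their transforms
converge pointwise by dominated convergence, so Fatou's lemma yields the inequality. -/
theorem lintegral_enorm_planeStockwell_sq_le {φ f : Plane → ℂ} (hf : Measurable f)
    (hf2 : MemLp f 2 mu2) (hφ : Measurable φ) (hφ1 : MemLp φ 1 mu2) (hφ2 : MemLp φ 2 mu2) :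
    ∫⁻ z, ‖planeStockwell φ f z‖ₑ ^ 2 ∂mu4 ≤ planeAdm φ * ∫⁻ x, ‖f x‖ₑ ^ 2 ∂mu2 := by
  set F : ℕ → Plane → ℂ := fun n => (Metric.closedBall (0 : Plane) n).indicator f with hF
  have hms : ∀ n : ℕ, MeasurableSet (Metric.closedBall (0 : Plane) n) :=
    fun n => Metric.isClosed_closedBall.measurableSet
  have hFm : ∀ n, Measurable (F n) := fun n => hf.indicator (hms n)
  have hF2 : ∀ n, MemLp (F n) 2 mu2 := fun n => hf2.indicator (hms n)
  have hF1 : ∀ n, MemLp (F n) 1 mu2 := fun n => by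
    have hfin : mu2 (Metric.closedBall (0 : Plane) n) ≠ ∞ :=
      (isCompact_closedBall (0 : Plane) (n : ℝ)).measure_lt_top.ne
    exact (hF2 n).mono_exponent_of_measure_support_ne_top
      (fun x hx => Set.indicator_of_notMem hx f) hfin (by norm_num)
  have hle : ∀ n x, ‖F n x‖ ≤ ‖f x‖ := fun n x => norm_indicator_le_norm_self f x
  have hlim : ∀ z, Filter.Tendsto (fun n => planeStockwell φ (F n) z) Filter.atTop
      (nhds (planeStockwell φ f z)) := fun z => by
    by_cases hd : detA z.1 = 0
    · simp [planeStockwell, hd]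
    refine Filter.Tendsto.const_smul ?_ _
    have hI := integrable_planeStockwell_integrand hf2 hφ2 hd z.2
    refine tendsto_integral_of_dominated_convergence _
      (fun n => (integrable_planeStockwell_integrand (hF2 n) hφ2 hd z.2).1) hI.norm
      (fun n => Filter.Eventually.of_forall fun x => ?_)
      (Filter.Eventually.of_forall fun x => ?_)
    · simp only [norm_mul]
      gcongr
      exact hle n x
    · refine tendsto_const_nhds.congr' ?_
      obtain ⟨N, hN⟩ := exists_nat_ge ‖x‖
      filter_upwards [Filter.eventually_ge_atTop N] with n hn
      have : x ∈ Metric.closedBall (0 : Plane) n := by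
        rw [mem_closedBall_zero_iff]
        exact hN.trans (by exact_mod_cast hn)
      simp [hF, Set.indicator_of_mem this]
  have hbd : ∀ n, ∫⁻ z, ‖planeStockwell φ (F n) z‖ₑ ^ 2 ∂mu4 ≤
      planeAdm φ * ∫⁻ x, ‖f x‖ₑ ^ 2 ∂mu2 := fun n => by
    rw [mu4_eq_prod, lintegral_prod _
      ((stronglyMeasurable_planeStockwell hφ (hFm n)).measurable.enorm.pow_const 2).aemeasurable,
      lintegral_enorm_planeStockwell_sq (hF1 n) (hF2 n) hφ1 hφ2]
    gcongr with x
    rw [← ofReal_norm, ← ofReal_norm]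
    exact ENNReal.ofReal_le_ofReal (hle n x)
  calc ∫⁻ z, ‖planeStockwell φ f z‖ₑ ^ 2 ∂mu4
      = ∫⁻ z, Filter.liminf (fun n => ‖planeStockwell φ (F n) z‖ₑ ^ 2) Filter.atTop ∂mu4 := by
        refine lintegral_congr fun z => ?_
        exact ((ENNReal.continuous_pow 2).tendsto _ |>.comp (hlim z).enorm).liminf_eq.symm
    _ ≤ Filter.liminf (fun n => ∫⁻ z, ‖planeStockwell φ (F n) z‖ₑ ^ 2 ∂mu4) Filter.atTop :=
        lintegral_liminf_le fun n =>
          (stronglyMeasurable_planeStockwell hφ (hFm n)).measurable.enorm.pow_const 2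
    _ ≤ Filter.liminf (fun _ : ℕ => planeAdm φ * ∫⁻ x, ‖f x‖ₑ ^ 2 ∂mu2) Filter.atTop :=
        Filter.liminf_le_liminf (Filter.Eventually.of_forall hbd)
    _ = _ := Filter.liminf_const _

/-! ### Splitting quaternions into two complex components -/

/-- Writing `q = α + i β` with `α, β ∈ ℝ + ℝ j ≅ ℂ`, this is the map `q ↦ α + j β`. -/
noncomputable def plusPart : ℍ[ℝ] →L[ℝ] ℂ :=
  LinearMap.toContinuousLinearMap
    { toFun := fun q => ⟨q.re - q.imK, q.imI + q.imJ⟩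
      map_add' := fun p q => by
        apply Complex.ext <;> simp <;> ring
      map_smul' := fun c q => by
        apply Complex.ext <;> simp <;> ring }

/-- Writing `q = α + i β` with `α, β ∈ ℝ + ℝ j ≅ ℂ`, this is the map `q ↦ α - j β`. -/
noncomputable def minusPart : ℍ[ℝ] →L[ℝ] ℂ :=
  LinearMap.toContinuousLinearMap
    { toFun := fun q => ⟨q.re + q.imK, q.imJ - q.imI⟩
      map_add' := fun p q => by
        apply Complex.ext <;> simp <;> ring
      map_smul' := fun c q => by
        apply Complex.ext <;> simp <;> ring }

/-- The embedding of `ℂ` into the quaternions with `I ↦ j`. -/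
def embedJ (z : ℂ) : ℍ[ℝ] := ⟨z.re, 0, z.im, 0⟩

@[simp] theorem qi_re : qi.re = 0 := rfl
@[simp] theorem qi_imI : qi.imI = 1 := rfl
@[simp] theorem qi_imJ : qi.imJ = 0 := rfl
@[simp] theorem qi_imK : qi.imK = 0 := rfl
@[simp] theorem qj_re : qj.re = 0 := rfl
@[simp] theorem qj_imI : qj.imI = 0 := rfl
@[simp] theorem qj_imJ : qj.imJ = 1 := rfl
@[simp] theorem qj_imK : qj.imK = 0 := rfl
@[simp] theorem embedJ_re (z : ℂ) : (embedJ z).re = z.re := rfl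
@[simp] theorem embedJ_imI (z : ℂ) : (embedJ z).imI = 0 := rfl
@[simp] theorem embedJ_imJ (z : ℂ) : (embedJ z).imJ = z.im := rfl
@[simp] theorem embedJ_imK (z : ℂ) : (embedJ z).imK = 0 := rfl

theorem plusPart_apply (q : ℍ[ℝ]) : plusPart q = ⟨q.re - q.imK, q.imI + q.imJ⟩ := rfl

theorem minusPart_apply (q : ℍ[ℝ]) : minusPart q = ⟨q.re + q.imK, q.imJ - q.imI⟩ := rfl

@[simp] theorem plusPart_embedJ (z : ℂ) : plusPart (embedJ z) = z := by
  apply Complex.ext <;> simp [plusPart_apply]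

@[simp] theorem minusPart_embedJ (z : ℂ) : minusPart (embedJ z) = z := by
  apply Complex.ext <;> simp [minusPart_apply]

theorem plusPart_mul_embedJ (q : ℍ[ℝ]) (z : ℂ) : plusPart (q * embedJ z) = plusPart q * z := by
  apply Complex.ext <;> simp [plusPart_apply] <;> ring

theorem minusPart_mul_embedJ (q : ℍ[ℝ]) (z : ℂ) :
    minusPart (q * embedJ z) = minusPart q * z := by
  apply Complex.ext <;> simp [minusPart_apply] <;> ring

/-- As `ji = -ij`, left multiplication by `j` sends `(α, β)` to `(jα, -jβ)` and so exchanges the two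
components. This is how the commutation hypothesis couples them. -/
theorem plusPart_qj_mul (q : ℍ[ℝ]) : plusPart (qj * q) = Complex.I * minusPart q := by
  apply Complex.ext <;> simp [plusPart_apply, minusPart_apply] <;> ring

theorem minusPart_qj_mul (q : ℍ[ℝ]) : minusPart (qj * q) = Complex.I * plusPart q := by
  apply Complex.ext <;> simp [plusPart_apply, minusPart_apply]

theorem star_embedJ (z : ℂ) : star (embedJ z) = embedJ (conj z) := by
  apply Quaternion.ext <;> simp

theorem embedJ_plusPart_of_eq {q : ℍ[ℝ]} (h : plusPart q = minusPart q) :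
    embedJ (plusPart q) = q := by
  have h1 := congrArg Complex.re h
  have h2 := congrArg Complex.im h
  simp only [plusPart_apply, minusPart_apply] at h1 h2
  apply Quaternion.ext <;> simp [plusPart_apply] <;> linarith

/-- The parallelogram law for `α` and `jβ`, with `‖q‖² = |α|² + |β|²`. -/
theorem enorm_plusPart_sq_add (q : ℍ[ℝ]) :
    ‖plusPart q‖ₑ ^ 2 + ‖minusPart q‖ₑ ^ 2 = 2 * ‖q‖ₑ ^ 2 := by
  have h : ‖plusPart q‖ ^ 2 + ‖minusPart q‖ ^ 2 = 2 * ‖q‖ ^ 2 := by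
    rw [Complex.sq_norm, Complex.sq_norm, sq ‖q‖, ← Quaternion.normSq_eq_norm_mul_self,
      Quaternion.normSq_def', Complex.normSq_apply, Complex.normSq_apply]
    simp only [plusPart_apply, minusPart_apply]
    ring
  simp only [← ofReal_norm]
  rw [← ENNReal.ofReal_pow (norm_nonneg _), ← ENNReal.ofReal_pow (norm_nonneg _),
    ← ENNReal.ofReal_pow (norm_nonneg _), ← ENNReal.ofReal_add (by positivity) (by positivity), h,
    ENNReal.ofReal_mul (by norm_num)]
  simp

theorem exp_smul_of_re_eq_zero {u : ℍ[ℝ]} (hu : u.re = 0) (hn : ‖u‖ = 1) (θ : ℝ) :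
    NormedSpace.exp (θ • u) = (Real.cos θ : ℍ[ℝ]) + Real.sin θ • u := by
  rw [Quaternion.exp_of_re_eq_zero _ (by simp [hu]), norm_smul, hn, mul_one, Real.norm_eq_abs,
    Real.cos_abs, smul_smul]
  congr 2
  rcases eq_or_ne θ 0 with rfl | h
  · simp
  rcases abs_cases θ with ⟨h1, -⟩ | ⟨h1, -⟩ <;> rw [h1]
  · field_simp
  · rw [Real.sin_neg]; field_simp

theorem norm_eq_one_of_normSq {q : ℍ[ℝ]} (h : Quaternion.normSq q = 1) : ‖q‖ = 1 := by
  rw [Quaternion.normSq_eq_norm_mul_self] at h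
  nlinarith [norm_nonneg q]

theorem norm_qi : ‖qi‖ = 1 := norm_eq_one_of_normSq (by simp [Quaternion.normSq_def'])

theorem norm_qj : ‖qj‖ = 1 := norm_eq_one_of_normSq (by simp [Quaternion.normSq_def'])

theorem expI_eq (θ : ℝ) : expI θ = (Real.cos θ : ℍ[ℝ]) + Real.sin θ • qi :=
  exp_smul_of_re_eq_zero rfl norm_qi θ

theorem expJ_eq_cos_add_sin (θ : ℝ) : expJ θ = (Real.cos θ : ℍ[ℝ]) + Real.sin θ • qj :=
  exp_smul_of_re_eq_zero rfl norm_qj θ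

theorem expJ_eq (θ : ℝ) : expJ θ = embedJ (Complex.exp (θ * Complex.I)) := by
  rw [expJ_eq_cos_add_sin, Complex.exp_mul_I]
  apply Quaternion.ext <;> simp [Complex.cos_ofReal_re, Complex.sin_ofReal_re]

theorem expJ_zero : expJ 0 = 1 := by simp [expJ]

theorem expJ_pi_div_two : expJ (Real.pi / 2) = qj := by
  rw [expJ_eq]
  have : ((Real.pi / 2 : ℝ) : ℂ) = Real.pi / 2 := by push_cast; ring
  rw [this, Complex.exp_pi_div_two_mul_I]
  apply Quaternion.ext <;> simp

theorem qj_eq_embedJ : qj = embedJ Complex.I := by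
  apply Quaternion.ext <;> simp

/-- From `i(α + iβ) = -β + iα`, left multiplication by `i` acts as `I` on `α + jβ` and as `-I` on `α
- jβ`. -/
theorem plusPart_expI_mul (θ : ℝ) (q : ℍ[ℝ]) :
    plusPart (expI θ * q) = Complex.exp (θ * Complex.I) * plusPart q := by
  rw [expI_eq, Complex.exp_mul_I]
  apply Complex.ext <;> simp [plusPart_apply, Complex.cos_ofReal_re, Complex.sin_ofReal_re] <;> ring

theorem minusPart_expI_mul (θ : ℝ) (q : ℍ[ℝ]) :
    minusPart (expI θ * q) = Complex.exp (-(θ * Complex.I)) * minusPart q := by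
  rw [expI_eq, ← neg_mul, Complex.exp_mul_I]
  apply Complex.ext <;>
    simp [minusPart_apply, Complex.cos_ofReal_re, Complex.sin_ofReal_re] <;> ring

theorem norm_expI (θ : ℝ) : ‖expI θ‖ = 1 :=
  norm_eq_one_of_normSq (by simp [Quaternion.normSq_def', expI_eq])

theorem norm_expJ (θ : ℝ) : ‖expJ θ‖ = 1 :=
  norm_eq_one_of_normSq (by simp [Quaternion.normSq_def', expJ_eq_cos_add_sin])

theorem continuous_expI : Continuous expI := by
  rw [funext expI_eq]
  exact (Quaternion.continuous_coe.comp Real.continuous_cos).add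
    (Real.continuous_sin.smul continuous_const)

theorem continuous_expJ : Continuous expJ := by
  rw [funext expJ_eq_cos_add_sin]
  exact (Quaternion.continuous_coe.comp Real.continuous_cos).add
    (Real.continuous_sin.smul continuous_const)

/-! ### Reflection and the components of the two-sided transform -/

/-- The reflection `(x₁, x₂) ↦ (-x₁, x₂)` of the plane. -/
def reflect (x : Plane) : Plane := (-x.1, x.2)

@[simp] theorem reflect_reflect (x : Plane) : reflect (reflect x) = x := by simp [reflect]

theorem measurable_reflect : Measurable reflect := by unfold reflect; fun_prop

theorem measurePreserving_reflect : MeasurePreserving reflect mu2 mu2 := by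
  have : MeasurePreserving reflect (volume : Measure Plane) volume :=
    (Measure.measurePreserving_neg (volume : Measure ℝ)).prod (MeasurePreserving.id volume)
  exact this.smul_measure _

theorem measurableEmbedding_reflect : MeasurableEmbedding reflect :=
  ((Homeomorph.neg ℝ).prodCongr (Homeomorph.refl ℝ)).measurableEmbedding

theorem planeChar_reflect_reflect (w x : Plane) :
    planeChar (reflect w) (reflect x) = planeChar w x := by
  simp [planeChar, reflect]

theorem planeFourier_comp_reflect (g : Plane → ℂ) (w : Plane) :
    planeFourier (fun x => g (reflect x)) w = planeFourier g (reflect w) := by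
  change _ = ∫ x, planeChar (reflect w) x * g x ∂mu2
  rw [← measurePreserving_reflect.integral_comp measurableEmbedding_reflect]
  simp_rw [planeChar_reflect_reflect]
  rfl

theorem plusPart_twoSided (a b : ℝ) (q : ℍ[ℝ]) (w x : Plane) (ha : a = -(x.1 * w.1))
    (hb : b = -(x.2 * w.2)) :
    plusPart (expI a * q * expJ b) = planeChar w x * plusPart q := by
  rw [expJ_eq, plusPart_mul_embedJ, plusPart_expI_mul, mul_right_comm, ← Complex.exp_add, planeChar,
    ha, hb]
  congr 2
  push_cast
  ring

/-- The opposite sign of `i` on this component reverses the first frequency, whence `reflect`. -/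
theorem minusPart_twoSided (a b : ℝ) (q : ℍ[ℝ]) (w x : Plane) (ha : a = -(x.1 * w.1))
    (hb : b = -(x.2 * w.2)) :
    minusPart (expI a * q * expJ b) = planeChar (reflect w) x * minusPart q := by
  rw [expJ_eq, minusPart_mul_embedJ, minusPart_expI_mul, mul_right_comm, ← Complex.exp_add,
    planeChar, ha, hb]
  congr 2
  simp only [reflect]
  push_cast
  ring

theorem memLp_twoSided {f : Plane → ℍ[ℝ]} {p : ℝ≥0∞} (hf : MemLp f p mu2) (w : Plane) :
    MemLp (fun x => expI (-(x.1 * w.1)) * f x * expJ (-(x.2 * w.2))) p mu2 := by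
  refine hf.of_le (((continuous_expI.comp (by fun_prop)).aestronglyMeasurable.mul hf.1).mul
    (continuous_expJ.comp (by fun_prop)).aestronglyMeasurable)
    (Filter.Eventually.of_forall fun x => ?_)
  rw [norm_mul, norm_mul, norm_expI, norm_expJ, one_mul, mul_one]

theorem plusPart_qFourier {g : Plane → ℍ[ℝ]} (hg : MemLp g 1 mu2) (w : Plane) :
    plusPart (qFourier g w) = planeFourier (fun x => plusPart (g x)) w := by
  rw [qFourier, ← plusPart.integral_comp_comm (memLp_one_iff_integrable.1 (memLp_twoSided hg w))]
  simp_rw [plusPart_twoSided _ _ _ w _ rfl rfl]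
  rfl

theorem minusPart_qFourier {g : Plane → ℍ[ℝ]} (hg : MemLp g 1 mu2) (w : Plane) :
    minusPart (qFourier g w) = planeFourier (fun x => minusPart (g x)) (reflect w) := by
  rw [qFourier, ← minusPart.integral_comp_comm (memLp_one_iff_integrable.1 (memLp_twoSided hg w))]
  simp_rw [minusPart_twoSided _ _ _ w _ rfl rfl]
  rfl

/-! ### Rigidity of windows under the commutation hypothesis -/

theorem ae_eq_of_planeFourier_ae_eq {g h : Plane → ℂ} (hg1 : MemLp g 1 mu2) (hg2 : MemLp g 2 mu2)
    (hh1 : MemLp h 1 mu2) (hh2 : MemLp h 2 mu2)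
    (H : ∀ᵐ w ∂mu2, planeFourier g w = planeFourier h w) : g =ᵐ[mu2] h := by
  have hi : ∀ {k : Plane → ℂ} (w : Plane), MemLp k 1 mu2 →
      Integrable (fun x => planeChar w x * k x) mu2 :=
    fun w hk => memLp_one_iff_integrable.1 (memLp_planeChar_mul w hk)
  have hsub : ∀ w, planeFourier (fun x => g x - h x) w = planeFourier g w - planeFourier h w := by
    intro w
    change ∫ x, planeChar w x * (g x - h x) ∂mu2 = _
    simp_rw [mul_sub]
    exact integral_sub (hi w hg1) (hi w hh1)
  have h0 := lintegral_enorm_planeFourier_sq (memLp_one_iff_integrable.1 (hg1.sub hh1))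
    (hg2.sub hh2)
  have h1 : ∫⁻ w, ‖planeFourier (g - h) w‖ₑ ^ 2 ∂mu2 = 0 := by
    rw [← lintegral_zero]
    refine lintegral_congr_ae ?_
    filter_upwards [H] with w hw
    have := hsub w
    rw [hw, sub_self] at this
    change ‖planeFourier (fun x => g x - h x) w‖ₑ ^ 2 = 0
    simp [this]
  rw [h1, eq_comm, lintegral_eq_zero_iff' ((hg1.sub hh1).1.enorm.pow_const 2)] at h0
  filter_upwards [h0] with x hx
  have : g x - h x = 0 := by simpa using hx
  exact sub_eq_zero.1 this

theorem planeFourier_const_mul (c : ℂ) (g : Plane → ℂ) (w : Plane) :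
    planeFourier (fun x => c * g x) w = c * planeFourier g w := by
  simp only [planeFourier, mul_left_comm _ c, integral_const_mul]

theorem memLp_clm_comp {g : Plane → ℍ[ℝ]} {p : ℝ≥0∞} (L : ℍ[ℝ] →L[ℝ] ℂ) (hg : MemLp g p mu2) :
    MemLp (fun x => L (g x)) p mu2 := L.comp_memLp' hg

/-- A window in `L¹ ∩ L²` satisfying the commutation hypothesis takes values in `ℝ + ℝ j` and is
even in the first variable. -/
theorem CommutationHyp.exists_embedJ {φ : Plane → ℍ[ℝ]} (h1 : MemLp φ 1 mu2) (h2 : MemLp φ 2 mu2)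
    (hc : CommutationHyp φ) : ∃ χ : Plane → ℂ, Measurable χ ∧ (∀ x, χ (reflect x) = χ x) ∧
      φ =ᵐ[mu2] fun x => embedJ (χ x) := by
  have hj1 : MemLp (fun x => qj * φ x) 1 mu2 := h1.const_mul qj
  have hp1 := memLp_clm_comp plusPart h1
  have hp2 := memLp_clm_comp plusPart h2
  have hm1 := memLp_clm_comp minusPart h1
  have hm2 := memLp_clm_comp minusPart h2
  -- The second identity at `y = 0`. Since `j` exchanges the components, it makes both of their
  -- Fourier transforms invariant under reflection.
  have hjF : ∀ w, qFourier (fun x => qj * φ x) w = qj * qFourier φ w := fun w => by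
    have := (hc w.1 w.2 0).2
    simpa [expJ_zero] using this
  have hme : ∀ w, planeFourier (fun x => minusPart (φ x)) w =
      planeFourier (fun x => minusPart (φ x)) (reflect w) := fun w => by
    have := congrArg plusPart (hjF w)
    rw [plusPart_qFourier hj1, plusPart_qj_mul, minusPart_qFourier h1] at this
    simp_rw [plusPart_qj_mul, planeFourier_const_mul] at this
    exact mul_left_cancel₀ Complex.I_ne_zero this
  have hpe : ∀ w, planeFourier (fun x => plusPart (φ x)) w =
      planeFourier (fun x => plusPart (φ x)) (reflect w) := fun w => by
    have := congrArg minusPart (hjF w)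
    rw [minusPart_qFourier hj1, minusPart_qj_mul, plusPart_qFourier h1] at this
    simp_rw [minusPart_qj_mul, planeFourier_const_mul] at this
    exact (mul_left_cancel₀ Complex.I_ne_zero this).symm
  have hpm : (fun x => plusPart (φ x)) =ᵐ[mu2] fun x => minusPart (φ x) := by
    refine ae_eq_of_planeFourier_ae_eq hp1 hp2 hm1 hm2 ?_
    filter_upwards [ae_mu2_coord_ne_zero] with w hw
    -- For `v ≠ 0` this `y` makes `e^{-jvy} = j`; a transform value commuting with `j` has equal
    -- components.
    have := (hc w.1 w.2 (-(Real.pi / 2 / w.2))).1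
    have e : -(w.2 * -(Real.pi / 2 / w.2)) = Real.pi / 2 := by
      have := hw.2
      field_simp
    rw [e, expJ_pi_div_two] at this
    have := congrArg plusPart this
    rw [plusPart_qj_mul, qj_eq_embedJ, plusPart_mul_embedJ, mul_comm] at this
    have := mul_left_cancel₀ Complex.I_ne_zero this
    rwa [plusPart_qFourier h1, minusPart_qFourier h1, ← hme] at this
  have heven : (fun x => plusPart (φ (reflect x))) =ᵐ[mu2] fun x => plusPart (φ x) := by
    refine ae_eq_of_planeFourier_ae_eq (hp1.comp_measurePreserving measurePreserving_reflect)
      (hp2.comp_measurePreserving measurePreserving_reflect) hp1 hp2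
      (Filter.Eventually.of_forall fun w => ?_)
    rw [hpe]
    exact planeFourier_comp_reflect (fun x => plusPart (φ x)) w
  set ψ := hp1.1.mk _ with hψ
  have hψm : Measurable ψ := hp1.1.stronglyMeasurable_mk.measurable
  have hψe : (fun x => plusPart (φ x)) =ᵐ[mu2] ψ := hp1.1.ae_eq_mk
  -- Symmetrizing the measurable representative makes evenness hold everywhere without changing its
  -- a.e. class.
  refine ⟨fun x => (ψ x + ψ (reflect x)) / 2,
    (hψm.add (hψm.comp measurable_reflect)).div_const 2, fun x => ?_, ?_⟩
  · simp only [reflect_reflect, add_comm]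
  · filter_upwards [hpm, heven, hψe,
      measurePreserving_reflect.quasiMeasurePreserving.ae hψe] with x a1 a2 a3 a4
    rw [← a3, ← a4, a2, add_self_div_two, embedJ_plusPart_of_eq a1]

/-! ### The quaternion Stockwell transform: uniform and `L²` bounds -/

/-- For `det A_ξ ≠ 0` the map `x ↦ A_ξ(x - b)` pulls null sets back to null sets; otherwise both
transforms are `0`. Hence window and signal may be replaced by convenient representatives. -/
theorem stockwell_congr_ae {φ φ' f f' : Plane → ℍ[ℝ]} (hφ : φ =ᵐ[mu2] φ') (hf : f =ᵐ[mu2] f') :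
    stockwell φ f = stockwell φ' f' := by
  funext z
  by_cases hd : detA z.1 = 0
  · simp [stockwell, hd]
  have h1 : z.1.1 ≠ 0 := left_ne_zero_of_mul hd
  have h2 : z.1.2 ≠ 0 := right_ne_zero_of_mul hd
  have hq : Measure.QuasiMeasurePreserving (dilate z.1) mu2 mu2 :=
    ⟨measurable_dilate z.1, by
      rw [map_dilate_mu2 h1 h2]; exact Measure.smul_absolutelyContinuous⟩
  have hq' := hq.comp (measurePreserving_sub_right mu2 z.2).quasiMeasurePreserving
  simp only [stockwell]
  congr 1
  refine integral_congr_ae ?_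
  filter_upwards [hf, hq'.ae hφ] with x hx hx'
  have hx'' : φ (dilate z.1 (x - z.2)) = φ' (dilate z.1 (x - z.2)) := hx'
  rw [hx, hx'']

theorem memLp_star {α : Type*} [MeasurableSpace α] {μ : Measure α} {g : α → ℍ[ℝ]} {p : ℝ≥0∞}
    (hg : MemLp g p μ) : MemLp (fun x => star (g x)) p μ :=
  hg.of_le (continuous_star.comp_aestronglyMeasurable hg.1)
    (Filter.Eventually.of_forall fun x => by simp)

theorem integrable_stockwell_integrand {φ f : Plane → ℍ[ℝ]} (hφ : MemLp φ 2 mu2)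
    (hf : MemLp f 2 mu2) {ξ : Plane} (hd : detA ξ ≠ 0) (b : Plane) :
    Integrable (fun x => expI (-(x.1 * ξ.1)) * f x * expJ (-(x.2 * ξ.2)) *
      star (φ (dilate ξ (x - b)))) mu2 :=
  (memLp_twoSided hf ξ).integrable_mul
    ((memLp_star (memLp_comp_dilate (left_ne_zero_of_mul hd) (right_ne_zero_of_mul hd)
      hφ)).comp_measurePreserving (measurePreserving_sub_right mu2 b))

/-- Cauchy–Schwarz: the exponentials have modulus one, and the factor `|det A_ξ|^{1/2}` makes the
dilation an `L²` isometry. -/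
theorem enorm_stockwell_le {φ f : Plane → ℍ[ℝ]} (hφ : MemLp φ 2 mu2) (hf : MemLp f 2 mu2)
    (z : Plane × Plane) :
    ‖stockwell φ f z‖ₑ ≤ eLpNorm φ 2 mu2 * eLpNorm f 2 mu2 := by
  by_cases hd : detA z.1 = 0
  · simp [stockwell, hd]
  have h1 : z.1.1 ≠ 0 := left_ne_zero_of_mul hd
  have h2 : z.1.2 ≠ 0 := right_ne_zero_of_mul hd
  have hs := measurePreserving_sub_right mu2 z.2
  have hφd := memLp_comp_dilate h1 h2 hφ
  have hg := (memLp_star hφd).comp_measurePreserving hs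
  have hb := enorm_integral_mul_le (memLp_twoSided hf z.1).1 hg.1
  have e1 : eLpNorm (fun x => expI (-(x.1 * z.1.1)) * f x * expJ (-(x.2 * z.1.2))) 2 mu2 =
      eLpNorm f 2 mu2 := eLpNorm_congr_norm_ae (Filter.Eventually.of_forall fun x => by
    rw [norm_mul, norm_mul, norm_expI, norm_expJ, one_mul, mul_one])
  have e2 := eLpNorm_comp_measurePreserving (p := 2) (memLp_star hφd).1 hs
  have e3 : eLpNorm (fun x => star (φ (dilate z.1 x))) 2 mu2 =
      eLpNorm (fun x => φ (dilate z.1 x)) 2 mu2 :=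
    eLpNorm_congr_norm_ae (Filter.Eventually.of_forall fun x => norm_star _)
  rw [e2, e1, e3] at hb
  rw [← eLpNorm_two_comp_dilate φ h1 h2, stockwell, enorm_smul,
    Real.enorm_of_nonneg (by positivity), mul_assoc]
  gcongr
  rw [mul_comm]
  exact hb

theorem plusPart_stockwell {χ : Plane → ℂ} {f : Plane → ℍ[ℝ]}
    (hχ : MemLp (fun x => embedJ (χ x)) 2 mu2) (hf : MemLp f 2 mu2) (z : Plane × Plane) :
    plusPart (stockwell (fun x => embedJ (χ x)) f z) =
      planeStockwell χ (fun x => plusPart (f x)) z := by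
  by_cases hd : detA z.1 = 0
  · simp [stockwell, planeStockwell, hd]
  rw [stockwell, planeStockwell, map_smul,
    ← plusPart.integral_comp_comm (integrable_stockwell_integrand hχ hf hd z.2)]
  simp_rw [star_embedJ, plusPart_mul_embedJ, plusPart_twoSided _ _ _ z.1 _ rfl rfl]

/-- This component carries the character at the reflected frequency. Substituting `x ↦ reflect x`
restores the character and moves the reflection to `f` and `b`, while evenness of `χ` absorbs it in
the window. -/
theorem minusPart_stockwell {χ : Plane → ℂ} {f : Plane → ℍ[ℝ]}
    (hχ : MemLp (fun x => embedJ (χ x)) 2 mu2) (he : ∀ x, χ (reflect x) = χ x)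
    (hf : MemLp f 2 mu2) (z : Plane × Plane) :
    minusPart (stockwell (fun x => embedJ (χ x)) f z) =
      planeStockwell χ (fun x => minusPart (f (reflect x))) (z.1, reflect z.2) := by
  by_cases hd : detA z.1 = 0
  · simp [stockwell, planeStockwell, hd]
  rw [stockwell, planeStockwell, map_smul,
    ← minusPart.integral_comp_comm (integrable_stockwell_integrand hχ hf hd z.2),
    ← measurePreserving_reflect.integral_comp measurableEmbedding_reflect]
  congr 1
  refine integral_congr_ae (Filter.Eventually.of_forall fun x => ?_)
  have e : dilate z.1 (reflect x - z.2) = reflect (dilate z.1 (x - reflect z.2)) := by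
    ext <;> simp [dilate, reflect]
    ring
  simp only [star_embedJ]
  rw [minusPart_mul_embedJ, minusPart_twoSided _ _ _ z.1 _ rfl rfl, planeChar_reflect_reflect, e, he]

theorem stronglyMeasurable_stockwell {φ f : Plane → ℍ[ℝ]} (hφ : StronglyMeasurable φ)
    (hf : StronglyMeasurable f) : StronglyMeasurable (stockwell φ f) := by
  have h1 : StronglyMeasurable fun z : Plane × Plane => |detA z.1| ^ (1 / 2 : ℝ) := by
    refine Measurable.stronglyMeasurable ?_
    unfold detA; fun_prop
  have h2 : StronglyMeasurable fun q : (Plane × Plane) × Plane =>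
      expI (-(q.2.1 * q.1.1.1)) * f q.2 * expJ (-(q.2.2 * q.1.1.2)) *
        star (φ (dilate q.1.1 (q.2 - q.1.2))) := by
    refine (((continuous_expI.stronglyMeasurable.comp_measurable (by fun_prop)).mul
      (hf.comp_measurable measurable_snd)).mul
      (continuous_expJ.stronglyMeasurable.comp_measurable (by fun_prop))).mul
      (continuous_star.comp_stronglyMeasurable (hφ.comp_measurable ?_))
    unfold dilate
    fun_prop
  exact h1.smul (h2.integral_prod_right' (ν := mu2))

theorem continuous_embedJ : Continuous embedJ := by
  have : embedJ = fun z : ℂ => (z.re : ℍ[ℝ]) + z.im • qj := by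
    funext z
    apply Quaternion.ext <;> simp
  rw [this]
  exact (Quaternion.continuous_coe.comp Complex.continuous_re).add
    (Complex.continuous_im.smul continuous_const)

/-- The complex bounds for the two components are added; the factor 2 of the parallelogram law
occurs on both sides and cancels, and the reflection in `b` preserves `mu4`. -/
theorem lintegral_enorm_stockwell_sq_le {χ : Plane → ℂ} {f : Plane → ℍ[ℝ]} (hχ : Measurable χ)
    (h1 : MemLp (fun x => embedJ (χ x)) 1 mu2) (h2 : MemLp (fun x => embedJ (χ x)) 2 mu2)
    (he : ∀ x, χ (reflect x) = χ x) (hf : StronglyMeasurable f) (hf2 : MemLp f 2 mu2) :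
    ∫⁻ z, ‖stockwell (fun x => embedJ (χ x)) f z‖ₑ ^ 2 ∂mu4 ≤
      planeAdm χ * ∫⁻ x, ‖f x‖ₑ ^ 2 ∂mu2 := by
  have hχ1 : MemLp χ 1 mu2 := by simpa using memLp_clm_comp plusPart h1
  have hχ2 : MemLp χ 2 mu2 := by simpa using memLp_clm_comp plusPart h2
  have hp := memLp_clm_comp plusPart hf2
  have hm := memLp_clm_comp minusPart hf2
  have hpm : Measurable fun x => plusPart (f x) :=
    (plusPart.continuous.comp_stronglyMeasurable hf).measurable
  have hmm : Measurable fun x => minusPart (f x) :=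
    (minusPart.continuous.comp_stronglyMeasurable hf).measurable
  have hmm' := hmm.comp measurable_reflect
  have hr : MeasurePreserving (fun z : Plane × Plane => (z.1, reflect z.2)) mu4 mu4 := by
    rw [mu4_eq_prod]
    exact (MeasurePreserving.id mu2).prod measurePreserving_reflect
  have hre : MeasurableEmbedding (fun z : Plane × Plane => (z.1, reflect z.2)) :=
    MeasurableEmbedding.id.prodMap measurableEmbedding_reflect
  have b1 := lintegral_enorm_planeStockwell_sq_le hpm hp hχ hχ1 hχ2
  have b2 := lintegral_enorm_planeStockwell_sq_le hmm'
    (hm.comp_measurePreserving measurePreserving_reflect) hχ hχ1 hχ2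
  rw [← hr.lintegral_comp_emb hre] at b2
  have hrf := measurePreserving_reflect.lintegral_comp_emb measurableEmbedding_reflect
    (fun x => ‖minusPart (f x)‖ₑ ^ 2)
  simp only [Function.comp_apply] at b2
  rw [hrf] at b2
  have hmeas := (stronglyMeasurable_planeStockwell hχ hpm).measurable.enorm.pow_const 2
  have key : 2 * ∫⁻ z, ‖stockwell (fun x => embedJ (χ x)) f z‖ₑ ^ 2 ∂mu4 ≤
      2 * (planeAdm χ * ∫⁻ x, ‖f x‖ₑ ^ 2 ∂mu2) := by
    calc 2 * ∫⁻ z, ‖stockwell (fun x => embedJ (χ x)) f z‖ₑ ^ 2 ∂mu4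
        = ∫⁻ z, (‖planeStockwell χ (fun x => plusPart (f x)) z‖ₑ ^ 2 +
            ‖planeStockwell χ (fun x => minusPart (f (reflect x))) (z.1, reflect z.2)‖ₑ ^ 2)
              ∂mu4 := by
          rw [← lintegral_const_mul' _ _ (by norm_num)]
          refine lintegral_congr fun z => ?_
          rw [← enorm_plusPart_sq_add, plusPart_stockwell h2 hf2, minusPart_stockwell h2 he hf2]
      _ ≤ planeAdm χ * ∫⁻ x, ‖plusPart (f x)‖ₑ ^ 2 ∂mu2 +
            planeAdm χ * ∫⁻ x, ‖minusPart (f x)‖ₑ ^ 2 ∂mu2 := by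
          rw [lintegral_add_left hmeas]
          exact add_le_add b1 b2
      _ = 2 * (planeAdm χ * ∫⁻ x, ‖f x‖ₑ ^ 2 ∂mu2) := by
          rw [← mul_add, ← lintegral_add_left (hpm.enorm.pow_const 2)]
          simp_rw [enorm_plusPart_sq_add]
          rw [lintegral_const_mul' _ _ (by norm_num)]
          ring
  exact (ENNReal.mul_le_mul_iff_right (by norm_num) (by norm_num)).1 key

/-- The two components are the complex transform at `w` and at `reflect w`, which coincide by
evenness. This identifies the complex admissibility constant with `C_φ`. -/
theorem enorm_qFourier_star_embedJ {χ : Plane → ℂ} (h1 : MemLp (fun x => embedJ (χ x)) 1 mu2)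
    (he : ∀ x, χ (reflect x) = χ x) (w : Plane) :
    ‖qFourier (fun x => star (embedJ (χ x))) w‖ₑ ^ 2 =
      ‖planeFourier (fun x => conj (χ x)) w‖ₑ ^ 2 := by
  have h := enorm_plusPart_sq_add (qFourier (fun x => star (embedJ (χ x))) w)
  have hr : planeFourier (fun x => conj (χ x)) (reflect w) =
      planeFourier (fun x => conj (χ x)) w := by
    rw [← planeFourier_comp_reflect]
    simp_rw [he]
  rw [plusPart_qFourier (memLp_star h1), minusPart_qFourier (memLp_star h1)] at h
  simp_rw [star_embedJ, plusPart_embedJ, minusPart_embedJ, hr, ← two_mul] at h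
  simp_rw [star_embedJ]
  exact ((ENNReal.mul_right_inj (by norm_num) (by norm_num)).1 h).symm

theorem planeAdm_eq_ofReal_admConst {φ : Plane → ℍ[ℝ]} {χ : Plane → ℂ}
    (h1 : MemLp (fun x => embedJ (χ x)) 1 mu2) (he : ∀ x, χ (reflect x) = χ x)
    (hχ : φ =ᵐ[mu2] fun x => embedJ (χ x)) (hi : Integrable (admIntegrand φ) mu2) :
    planeAdm χ = ENNReal.ofReal (admConst φ) := by
  have hnn : ∀ ξ, 0 ≤ admIntegrand φ ξ := fun ξ => by unfold admIntegrand; positivity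
  rw [admConst, ofReal_integral_eq_lintegral_ofReal hi (Filter.Eventually.of_forall hnn), planeAdm]
  refine lintegral_congr fun ξ => ?_
  have hF : qFourier (fun x => star (φ x)) = qFourier (fun x => star (embedJ (χ x))) := by
    funext w
    refine integral_congr_ae ?_
    filter_upwards [hχ] with x hx
    rw [hx]
  rw [admIntegrand, hF, div_eq_mul_inv, ENNReal.ofReal_mul (by positivity),
    ENNReal.ofReal_pow (norm_nonneg _), ofReal_norm, enorm_qFourier_star_embedJ h1 he]

/-! ### Interpolation and conclusion -/

/-- Interpolation between `L²` and a uniform bound. -/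
theorem eLpNorm_le_of_enorm_le_of_lintegral_sq_le {α G : Type*} [MeasurableSpace α]
    [NormedAddCommGroup G] {μ : Measure α} {S : α → G} {M B : ℝ≥0∞} (hM : ∀ x, ‖S x‖ₑ ≤ M)
    (hB : ∫⁻ x, ‖S x‖ₑ ^ 2 ∂μ ≤ B) (hMt : M ≠ ∞) {p : ℝ} (hp : 2 ≤ p) :
    eLpNorm S (ENNReal.ofReal p) μ ≤ M ^ (1 - 2 / p) * B ^ (1 / p) := by
  have hp0 : 0 < p := by linarith
  have hle : ∫⁻ x, ‖S x‖ₑ ^ p ∂μ ≤ M ^ (p - 2) * B := by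
    calc ∫⁻ x, ‖S x‖ₑ ^ p ∂μ ≤ ∫⁻ x, M ^ (p - 2) * ‖S x‖ₑ ^ 2 ∂μ := by
          refine lintegral_mono fun x => ?_
          have : ‖S x‖ₑ ^ p = ‖S x‖ₑ ^ (p - 2) * ‖S x‖ₑ ^ 2 := by
            rw [← ENNReal.rpow_two, ← ENNReal.rpow_add_of_nonneg _ _ (by linarith) (by norm_num)]
            ring_nf
          rw [this]
          gcongr
          exact hM x
      _ ≤ M ^ (p - 2) * B := by
          rw [lintegral_const_mul' _ _ (ENNReal.rpow_ne_top_of_nonneg (by linarith) hMt)]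
          gcongr
  rw [eLpNorm_eq_lintegral_rpow_enorm_toReal (by simpa using hp0) ENNReal.ofReal_ne_top,
    ENNReal.toReal_ofReal hp0.le]
  refine (ENNReal.rpow_le_rpow hle (by positivity)).trans_eq ?_
  rw [ENNReal.mul_rpow_of_nonneg _ _ (by positivity), ← ENNReal.rpow_mul]
  congr 2
  field_simp

theorem eLpNorm_stockwell_le {φ f : Plane → ℍ[ℝ]} (hφ : IsAdmissible φ)
    (hcomm : CommutationHyp φ) (hf : MemLp f 2 mu2) {p : ℝ} (hp : 2 ≤ p) :
    AEStronglyMeasurable (stockwell φ f) mu4 ∧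
      eLpNorm (stockwell φ f) (ENNReal.ofReal p) mu4 ≤
        ENNReal.ofReal (admConst φ) ^ (1 / p) * eLpNorm φ 2 mu2 ^ (1 - 2 / p) *
          eLpNorm f 2 mu2 := by
  obtain ⟨χ, hχ, he, hφχ⟩ := hcomm.exists_embedJ hφ.memLp_one hφ.memLp_two
  have h1 := (memLp_congr_ae hφχ).1 hφ.memLp_one
  have h2 := (memLp_congr_ae hφχ).1 hφ.memLp_two
  have hS := stockwell_congr_ae hφχ hf.1.ae_eq_mk
  have hfm := hf.1.stronglyMeasurable_mk
  have hf2 := (memLp_congr_ae hf.1.ae_eq_mk).1 hf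
  have hB := lintegral_enorm_stockwell_sq_le hχ h1 h2 he hfm hf2
  rw [← hS, planeAdm_eq_ofReal_admConst h1 he hφχ hφ.integrable, lintegral_enorm_sq_eq (hf.1.mk f),
    ← eLpNorm_congr_ae hf.1.ae_eq_mk] at hB
  have hp0 : 0 < p := by linarith
  have h2p : 2 / p ≤ 1 := (div_le_one hp0).2 hp
  refine ⟨?_, ?_⟩
  · rw [hS]
    exact (stronglyMeasurable_stockwell
      (continuous_embedJ.comp_stronglyMeasurable hχ.stronglyMeasurable) hfm).aestronglyMeasurable
  · refine (eLpNorm_le_of_enorm_le_of_lintegral_sq_le (enorm_stockwell_le hφ.memLp_two hf) hB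
      (ENNReal.mul_ne_top hφ.memLp_two.eLpNorm_ne_top hf.eLpNorm_ne_top) hp).trans_eq ?_
    set a := eLpNorm φ 2 mu2
    set b := eLpNorm f 2 mu2
    -- The uniform bound contributes the exponent `1 - 2/p` of `‖f‖₂` and the `L²` bound contributes
    -- `2/p`.
    have hb : b ^ (1 - 2 / p) * (b ^ 2) ^ (1 / p) = b := by
      rw [← ENNReal.rpow_two, ← ENNReal.rpow_mul,
        ← ENNReal.rpow_add_of_nonneg _ _ (by linarith) (by positivity)]
      ring_nf
      simp
    rw [ENNReal.mul_rpow_of_nonneg _ _ (by linarith), ENNReal.mul_rpow_of_nonneg _ _ (by positivity)]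
    calc _ = ENNReal.ofReal (admConst φ) ^ (1 / p) * a ^ (1 - 2 / p) *
          (b ^ (1 - 2 / p) * (b ^ 2) ^ (1 / p)) := by ring
      _ = _ := by rw [hb]

end QStockwell

theorem mainTheorem9 (φ f : QStockwell.Plane → ℍ[ℝ])
    (hφ : QStockwell.IsAdmissible φ) (hcomm : QStockwell.CommutationHyp φ)
    (hf : MemLp f 2 QStockwell.mu2) (p : ℝ) (hp : 2 ≤ p) :
    MemLp (QStockwell.stockwell φ f) (ENNReal.ofReal p) QStockwell.mu4 ∧
      (eLpNorm (QStockwell.stockwell φ f) (ENNReal.ofReal p) QStockwell.mu4).toReal ≤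
        QStockwell.admConst φ ^ (1 / p) *
          (eLpNorm φ 2 QStockwell.mu2).toReal ^ (1 - 2 / p) *
          (eLpNorm f 2 QStockwell.mu2).toReal := by
  obtain ⟨hm, hle⟩ := QStockwell.eLpNorm_stockwell_le hφ hcomm hf hp
  have hp0 : 0 < p := by linarith
  have h2p : 2 / p ≤ 1 := (div_le_one hp0).2 hp
  have hfin : ENNReal.ofReal (QStockwell.admConst φ) ^ (1 / p) *
      eLpNorm φ 2 QStockwell.mu2 ^ (1 - 2 / p) * eLpNorm f 2 QStockwell.mu2 ≠ ∞ :=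
    ENNReal.mul_ne_top (ENNReal.mul_ne_top
      (ENNReal.rpow_ne_top_of_nonneg (by positivity) ENNReal.ofReal_ne_top)
      (ENNReal.rpow_ne_top_of_nonneg (by linarith) hφ.memLp_two.eLpNorm_ne_top)) hf.eLpNorm_ne_top
  refine ⟨⟨hm, hle.trans_lt hfin.lt_top⟩, (ENNReal.toReal_mono hfin hle).trans_eq ?_⟩
  rw [ENNReal.toReal_mul, ENNReal.toReal_mul, ← ENNReal.toReal_rpow, ← ENNReal.toReal_rpow,
    ENNReal.toReal_ofReal hφ.pos.le]
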